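/- Let $k$ be a field and let $y,z,t_1,t_2,\dots$ be independent indeterminates over $k$. Let $S$ be the monoid of all monomials $f$ of $k[y,z,t_1,t_2,\dots]$ such that $\deg_{y,z} f\ge \deg_{t_n} f$ for all $n\ge 1$ (where $\deg_{y,z}f$ is the total degree of $f$ in $y$ and $z$), let $R=k[S]$ be the $k$-subalgebra of $k[y,z,t_1,t_2,\dots]$ generated by $S$, let $K$ be the field of fractions of $R$, and let $X$ be an indeterminate over $R$. Put $$P=(y+zX)K[X]\cap R[X],\qquad Q=(y,z)\,k[y,z,t_1,t_2,\dots]\cap R .$$ Terminology, for an integral domain $D$ with field of fractions $L$: for a nonzero fractional ideal $I$ of $D$ put $(D:I)=\{x\in L : xI\subseteq D\}$, $I_v=(D:(D:I))$ and $I_t=\bigcup J_v$, the union over all nonzero finitely generated fractional ideals $J\subseteq I$. A nonzero fractional ideal $I$ is divisorial if $I=I_v$, a $t$-ideal if $I=I_t$, and $v$-invertible if $(I(D:I))_v=D$. A maximal divisorial (respectively $t$-maximal) ideal of $D$ is a maximal element of the set of divisorial ideals (respectively $t$-ideals) properly contained in $D$. An upper to zero of $D[X]$ is a nonzero prime ideal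 of $D[X]$ whose intersection with $D$ is $(0)$. The domain $D$ is completely integrally closed if every $s\in L$ for which there is a nonzero $r\in D$ with $rs^n\in D$ for all $n\ge 0$ lies in $D$. Then: 1. $R$ and $R[X]$ are completely integrally closed. 2. $P$ is an upper to zero of $R[X]$ that is $v$-invertible and a maximal divisorial ideal of $R[X]$. 3. $P$ is not $t$-maximal; indeed $QR[X]$ is a proper $t$-ideal of $R[X]$ and $P\subsetneq QR[X]$. -/

import Mathlib

open scoped nonZeroDivisors Polynomial

/-! ### Divisorial ideals and `t`-ideals of an integral domain -/

namespace StarIdeals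

variable {D : Type*} [CommRing D] [IsDomain D]

/-- An integral ideal of `D`, viewed as a fractional ideal. -/
noncomputable abbrev frac (I : Ideal D) : FractionalIdeal D⁰ (FractionRing D) := I

/-- The `v`-closure `I_v = (D : (D : I))` of a nonzero fractional ideal `I` of the domain `D`,
where `(D : I) = {x in the fraction field | x I ⊆ D}`.
(On nonzero fractional ideals `1 / I` is exactly `(D : I)`; every notion below is
restricted to nonzero `I`.) -/
noncomputable def vClosure (I : FractionalIdeal D⁰ (FractionRing D)) :
    FractionalIdeal D⁰ (FractionRing D) :=
  1 / (1 / I)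

/-- The `t`-closure `I_t`: the union of the `J_v`, over all nonzero finitely generated
fractional ideals `J` contained in `I`. -/
def tClosure (I : FractionalIdeal D⁰ (FractionRing D)) : Set (FractionRing D) :=
  {x | ∃ J : FractionalIdeal D⁰ (FractionRing D),
    J ≠ 0 ∧ (J : Submodule D (FractionRing D)).FG ∧ J ≤ I ∧ x ∈ vClosure J}

/-- `I` is divisorial (a `v`-ideal): `I` is nonzero and `I = I_v`. -/
def IsDivisorial (I : FractionalIdeal D⁰ (FractionRing D)) : Prop :=
  I ≠ 0 ∧ vClosure I = I

/-- `I` is a `t`-ideal: `I` is nonzero and `I = I_t`. -/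
def IsTIdeal (I : FractionalIdeal D⁰ (FractionRing D)) : Prop :=
  I ≠ 0 ∧ tClosure I = {x | x ∈ I}

/-- `I` is `v`-invertible: `I` is nonzero and `(I (D : I))_v = D`. -/
def IsVInvertible (I : FractionalIdeal D⁰ (FractionRing D)) : Prop :=
  I ≠ 0 ∧ vClosure (I * (1 / I)) = 1

/-- A maximal divisorial (`v`-maximal) ideal of `D`: maximal among the proper integral
divisorial ideals. -/
def IsMaximalDivisorial (M : Ideal D) : Prop :=
  Maximal (fun J : Ideal D =>
    J ≠ ⊤ ∧ IsDivisorial (frac J)) M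

/-- A `t`-maximal ideal of `D`: maximal among the proper integral `t`-ideals. -/
def IsTMaximal (M : Ideal D) : Prop :=
  Maximal (fun J : Ideal D =>
    J ≠ ⊤ ∧ IsTIdeal (frac J)) M

/-- An upper to zero of `D[X]`: a nonzero prime ideal of `D[X]` that meets `D` in `0`. -/
def IsUpperToZero (P : Ideal D[X]) : Prop :=
  P.IsPrime ∧ P ≠ ⊥ ∧ P.comap Polynomial.C = ⊥

variable (D) in
/-- `D` is completely integrally closed: an element `s` of the fraction field for which there
is a nonzero `r` in `D` with `r s ^ n ∈ D` for all `n` lies in `D`. -/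
def IsCompletelyIntegrallyClosed : Prop :=
  completeIntegralClosure D (FractionRing D) = ⊥

end StarIdeals

/-! ### The monomial ring -/

namespace MonomialExample

/-- The indeterminates `y`, `z` and `t_n` (the index set of the `t_n` is `{1, 2, …}`). -/
inductive Var : Type
  | y : Var
  | z : Var
  | t : ℕ+ → Var

variable (k : Type*) [Field k]

/-- The monoid `S` of monomials `f` of `k[y, z, t]` with `deg_{y,z} f ≥ deg_{t_n} f` for all `n`. -/
noncomputable def S : Submonoid (MvPolynomial Var k) where
  carrier := {f | ∃ m : Var →₀ ℕ,
    (∀ n : ℕ+, m (Var.t n) ≤ m Var.y + m Var.z) ∧ f = MvPolynomial.monomial m 1}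
  one_mem' := ⟨0, by simp, rfl⟩
  mul_mem' := by
    rintro _ _ ⟨m, hm, rfl⟩ ⟨m', hm', rfl⟩
    refine ⟨m + m', fun n => ?_, by simp [MvPolynomial.monomial_mul]⟩
    have h₁ := hm n
    have h₂ := hm' n
    simp only [Finsupp.add_apply]
    omega

/-- The ring `R = k[S]`, as the `k`-subalgebra of `k[y, z, t]` generated by `S`. -/
noncomputable abbrev R : Subalgebra k (MvPolynomial Var k) :=
  Algebra.adjoin k (S k : Set (MvPolynomial Var k))

/-- `y` as an element of `R`. -/
noncomputable def yR : R k :=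
  ⟨MvPolynomial.X Var.y, Algebra.subset_adjoin
    ⟨Finsupp.single Var.y 1, fun n => by simp, rfl⟩⟩

/-- `z` as an element of `R`. -/
noncomputable def zR : R k :=
  ⟨MvPolynomial.X Var.z, Algebra.subset_adjoin
    ⟨Finsupp.single Var.z 1, fun n => by simp, rfl⟩⟩

/-- The ideal `P = (y + z X) K[X] ∩ R[X]` of `R[X]`, where `K` is the fraction field of `R`. -/
noncomputable def P : Ideal (R k)[X] :=
  (Ideal.span {(Polynomial.C (yR k) + Polynomial.C (zR k) * Polynomial.X).map
      (algebraMap (R k) (FractionRing (R k)))}).comap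
    (Polynomial.mapRingHom (algebraMap (R k) (FractionRing (R k))))

/-- The ideal `Q = (y, z) k[y, z, t] ∩ R` of `R`. -/
noncomputable def Q : Ideal (R k) :=
  (Ideal.span {MvPolynomial.X Var.y, MvPolynomial.X Var.z}).comap
    (algebraMap (R k) (MvPolynomial Var k))

/-- The ideal `Q R[X]` of `R[X]`. -/
noncomputable def QRX : Ideal (R k)[X] :=
  (Q k).map Polynomial.C

end MonomialExample

/-! Each weight with y, z of weight 1, t_n of weight -1 and the other variables of weight 0 gives an
additive order on the factorial ring k[y,z,t], and R is cut out by "order ≥ 0 for every n". An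
element almost integral over R therefore lies in k[y,z,t], and then in R;
`IsCompletelyIntegrallyClosed.polynomial` passes to R[X].

Since yf ∈ R exactly when zf ∈ R, P = R[X] ∩ ((y + zX)/z) R[X] (`mem_P_iff`), so P is divisorial.
Complete integral closedness makes it v-invertible, and a v-invertible divisorial prime is maximal
divisorial.

Finitely many elements of QR[X] involve finitely many variables, so some t_n is absent from all of
them. This t_n, the fraction (y t_n)/y of K, multiplies them into R[X], while t_n g ∈ R[X] forces g
∈ QR[X]. So QR[X] is a t-ideal, and it contains P strictly. -/

namespace StarIdeals

/-! ### Divisorial, `t`- and `v`-invertible ideals of a domain. -/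

section Domain

variable {D : Type*} [CommRing D] [IsDomain D]

local notation "L" => FractionRing D

theorem le_one_div_of_le_one {I : FractionalIdeal D⁰ L} (hI : I ≠ 0) (h : I ≤ 1) :
    1 ≤ 1 / I := by
  rwa [FractionalIdeal.le_div_iff_mul_le hI, one_mul]

theorem inverse_ne_zero {I : FractionalIdeal D⁰ L} (hI : I ≠ 0) : 1 / I ≠ 0 := by
  obtain ⟨a, J, ha, h⟩ := FractionalIdeal.exists_eq_spanSingleton_mul I
  have hmem : algebraMap D L a ∈ 1 / I := by
    rw [FractionalIdeal.mem_div_iff_of_ne_zero hI]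
    intro y hy
    rw [h, FractionalIdeal.mem_singleton_mul] at hy
    obtain ⟨j, hj, rfl⟩ := hy
    rw [mul_inv_cancel_left₀ (by simpa using ha)]
    exact FractionalIdeal.coeIdeal_le_one hj
  rintro h0
  rw [h0, FractionalIdeal.mem_zero_iff] at hmem
  exact ha (by simpa using hmem)

theorem mul_inverse_ne_zero {I : FractionalIdeal D⁰ L} (hI : I ≠ 0) : I * (1 / I) ≠ 0 := by
  obtain ⟨r, hr0, hr⟩ := FractionalIdeal.exists_ne_zero_mem_isInteger (I := 1 / I) (inverse_ne_zero hI)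
  obtain ⟨s, hs0, hs⟩ := FractionalIdeal.exists_ne_zero_mem_isInteger hI
  intro h
  have := FractionalIdeal.mul_mem_mul hs hr
  rw [h, FractionalIdeal.mem_zero_iff, ← map_mul] at this
  exact mul_ne_zero hs0 hr0 (by simpa using this)

theorem one_div_le_one_div {I J : FractionalIdeal D⁰ L} (hI : I ≠ 0) (h : I ≤ J) :
    1 / J ≤ 1 / I := by
  have hJ : J ≠ 0 := fun hJ => hI (FractionalIdeal.le_zero_iff.mp (hJ ▸ h))
  rw [FractionalIdeal.le_div_iff_of_ne_zero hI]
  exact fun x hx y hy => (FractionalIdeal.mem_div_iff_of_ne_zero hJ).mp hx y (h hy)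

theorem le_vClosure {I : FractionalIdeal D⁰ L} (hI : I ≠ 0) : I ≤ vClosure I := by
  rw [vClosure, FractionalIdeal.le_div_iff_mul_le (J' := 1 / I) (inverse_ne_zero hI)]
  exact FractionalIdeal.mul_one_div_le_one

theorem vClosure_le_one {I : FractionalIdeal D⁰ L} (hI : I ≠ 0) (h : I ≤ 1) :
    vClosure I ≤ 1 := by
  rw [vClosure]
  refine (one_div_le_one_div ?_ (le_one_div_of_le_one hI h)).trans FractionalIdeal.div_one.le
  exact one_ne_zero' (FractionalIdeal D⁰ L)

theorem mem_vClosure {I : FractionalIdeal D⁰ L} (hI : I ≠ 0) {x : L} :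
    x ∈ vClosure I ↔ ∀ y ∈ 1 / I, x * y ∈ (1 : FractionalIdeal D⁰ L) :=
  FractionalIdeal.mem_div_iff_of_ne_zero (inverse_ne_zero hI)

/-- `J` lies in (D : I(D : I)), and 1 ∈ (I(D : I))_v multiplies that ideal into D. -/
theorem le_one_of_isVInvertible {I : FractionalIdeal D⁰ L} (hI : IsVInvertible I)
    {J : FractionalIdeal D⁰ L} (hJ : I * (1 / I) * J ≤ 1) : J ≤ 1 := by
  have h0 : I * (1 / I) ≠ 0 := mul_inverse_ne_zero hI.1
  have h1 : J ≤ 1 / (I * (1 / I)) := by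
    rwa [FractionalIdeal.le_div_iff_mul_le h0, mul_comm]
  intro x hx
  have := (mem_vClosure h0 (x := 1)).mp (by rw [hI.2]; exact FractionalIdeal.one_mem_one _) x (h1 hx)
  simpa using this

/-- Over a completely integrally closed domain every nonzero fractional ideal is `v`-invertible. -/
theorem IsCompletelyIntegrallyClosed.isVInvertible (hD : IsCompletelyIntegrallyClosed D)
    {I : FractionalIdeal D⁰ L} (hI : I ≠ 0) : IsVInvertible I := by
  have hI' := inverse_ne_zero hI
  have h0 : I * (1 / I) ≠ 0 := mul_inverse_ne_zero hI
  refine ⟨hI, ?_⟩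
  suffices h : 1 / (I * (1 / I)) = 1 by rw [vClosure, h, FractionalIdeal.div_one]
  refine le_antisymm (fun x hx => ?_)
    (le_one_div_of_le_one h0 FractionalIdeal.mul_one_div_le_one)
  -- All powers of `x` then preserve (D : I), so for nonzero r ∈ (D : I) and s ∈ I the element rs is
  -- a common denominator of all x ^ n.
  have hstep : ∀ b ∈ 1 / I, x * b ∈ 1 / I := by
    intro b hb
    rw [FractionalIdeal.mem_div_iff_of_ne_zero hI]
    intro a ha
    have := (FractionalIdeal.mem_div_iff_of_ne_zero h0).mp hx (a * b)
      (FractionalIdeal.mul_mem_mul ha hb)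
    rwa [mul_assoc, mul_comm b]
  obtain ⟨r, hr0, hr⟩ := FractionalIdeal.exists_ne_zero_mem_isInteger hI'
  obtain ⟨s, hs0, hs⟩ := FractionalIdeal.exists_ne_zero_mem_isInteger hI
  have hpow : ∀ n : ℕ, x ^ n * algebraMap D L r ∈ 1 / I := by
    intro n
    induction n with
    | zero => simpa using hr
    | succ n ih => rw [pow_succ', mul_assoc]; exact hstep _ ih
  have hx' : x ∈ completeIntegralClosure D L := by
    refine ⟨r * s, mem_nonZeroDivisors_of_ne_zero (mul_ne_zero hr0 hs0), fun n => ?_⟩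
    have := (FractionalIdeal.mem_div_iff_of_ne_zero hI).mp (hpow n) _ hs
    rw [FractionalIdeal.mem_one_iff] at this
    obtain ⟨c, hc⟩ := this
    exact ⟨c, by rw [hc, Algebra.smul_def, map_mul]; ring⟩
  rw [show completeIntegralClosure D L = ⊥ from hD, Algebra.mem_bot] at hx'
  exact (FractionalIdeal.mem_one_iff _).mpr hx'

/-- A `v`-invertible divisorial prime ideal is a maximal divisorial ideal. -/
theorem isMaximalDivisorial_of_isVInvertible {P : Ideal D} (hP : P.IsPrime)
    (hdiv : IsDivisorial (frac P)) (hinv : IsVInvertible (frac P)) : IsMaximalDivisorial P := by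
  refine ⟨⟨hP.ne_top, hdiv⟩, ?_⟩
  rintro J ⟨hJtop, hJ0, hJ⟩ hPJ
  by_contra hJP
  obtain ⟨b, hbJ, hbP⟩ := Set.not_subset.mp hJP
  have hle : frac P ≤ frac J := FractionalIdeal.coeIdeal_le_coeIdeal L |>.mpr hPJ
  -- With `b` in `J` but not in `P`, (xp)b = (xb)p lies in `P`, and primality removes `b`.
  have hsub : ∀ x ∈ 1 / frac J, ∀ p ∈ frac P, x * p ∈ frac P := by
    intro x hx p hp
    obtain ⟨p', hp', rfl⟩ := (FractionalIdeal.mem_coeIdeal _).mp hp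
    have hmem := (FractionalIdeal.mem_div_iff_of_ne_zero hJ0).mp hx
    obtain ⟨c, hc⟩ := (FractionalIdeal.mem_one_iff _).mp (hmem _ (hle hp))
    obtain ⟨d, hd⟩ := (FractionalIdeal.mem_one_iff _).mp
      (hmem _ (FractionalIdeal.mem_coeIdeal_of_mem _ hbJ))
    have hcb : c * b = d * p' := by
      apply FaithfulSMul.algebraMap_injective D L
      rw [map_mul, map_mul, hc, hd]; ring
    have : c * b ∈ P := hcb ▸ P.mul_mem_left d hp'
    rw [← hc]
    exact FractionalIdeal.mem_coeIdeal_of_mem _ ((hP.mem_or_mem this).resolve_right hbP)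
  have hJ1 : 1 / frac J ≤ 1 := by
    apply le_one_of_isVInvertible hinv
    have : 1 / frac J * frac P ≤ frac P := FractionalIdeal.mul_le.mpr hsub
    calc frac P * (1 / frac P) * (1 / frac J)
        = (1 / frac J * frac P) * (1 / frac P) := by rw [mul_comm, mul_assoc]
      _ ≤ frac P * (1 / frac P) := by gcongr
      _ ≤ 1 := FractionalIdeal.mul_one_div_le_one
  have h1 : (1 : FractionalIdeal D⁰ L) ≤ frac J := by
    rw [← hJ, vClosure, FractionalIdeal.le_div_iff_mul_le (J' := 1 / frac J) (inverse_ne_zero hJ0), one_mul]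
    exact hJ1
  have hfJ : frac J = 1 := le_antisymm FractionalIdeal.coeIdeal_le_one h1
  exact hJtop ((FractionalIdeal.coeIdeal_eq_one.mp hfJ).trans Ideal.one_eq_top)

/-- A divisorial ideal is obtained from conditions of the form `a * g ∈ b D`. -/
theorem isDivisorial_frac {I : Ideal D} (hI : I ≠ ⊥) {a b : D} (hb : b ≠ 0)
    (h : ∀ g, g ∈ I ↔ b ∣ a * g) : IsDivisorial (frac I) := by
  have hI0 : frac I ≠ 0 := FractionalIdeal.coeIdeal_ne_zero.mpr hI
  refine ⟨hI0, le_antisymm (fun x hx => ?_) (le_vClosure hI0)⟩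
  obtain ⟨g, rfl⟩ := (FractionalIdeal.mem_one_iff _).mp
    (vClosure_le_one hI0 FractionalIdeal.coeIdeal_le_one hx)
  have hb' : algebraMap D L b ≠ 0 := by simpa using hb
  -- Everything in I_v is then multiplied into D by a/b, which is the criterion for lying in I.
  have hmem : algebraMap D L a / algebraMap D L b ∈ 1 / frac I := by
    rw [FractionalIdeal.mem_div_iff_of_ne_zero hI0]
    intro y hy
    obtain ⟨g', hg', rfl⟩ := (FractionalIdeal.mem_coeIdeal _).mp hy
    obtain ⟨c, hc⟩ := (h g').mp hg'
    refine (FractionalIdeal.mem_one_iff _).mpr ⟨c, ?_⟩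
    rw [div_mul_eq_mul_div, eq_div_iff hb', ← map_mul, ← map_mul, hc, mul_comm]
  obtain ⟨c, hc⟩ := (FractionalIdeal.mem_one_iff _).mp ((mem_vClosure hI0).mp hx _ hmem)
  refine FractionalIdeal.mem_coeIdeal_of_mem _ ((h g).mpr ⟨c, ?_⟩)
  rw [mul_div_assoc', eq_div_iff hb', ← map_mul, ← map_mul] at hc
  rw [mul_comm b, FaithfulSMul.algebraMap_injective D L hc, mul_comm]

/-- `I` is a `t`-ideal if every finite subset of `I` lies in some `{g | b ∣ a * g}` inside `I`. -/
theorem isTIdeal_frac {I : Ideal D} (hI : I ≠ ⊥)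
    (h : ∀ s : Finset D, (s : Set D) ⊆ I →
      ∃ a b : D, b ≠ 0 ∧ (∀ g ∈ s, b ∣ a * g) ∧ ∀ g, b ∣ a * g → g ∈ I) :
    IsTIdeal (frac I) := by
  have hI0 : frac I ≠ 0 := FractionalIdeal.coeIdeal_ne_zero.mpr hI
  refine ⟨hI0, Set.Subset.antisymm ?_ ?_⟩
  · rintro x ⟨J, hJ0, hfg, hJI, hx⟩
    obtain ⟨s, hs⟩ := hfg
    have hsI : ∀ u ∈ s, u ∈ frac I := fun u hu => hJI (by
      change u ∈ (J : Submodule D L); rw [← hs]; exact Submodule.subset_span hu)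
    classical
    obtain ⟨s', hs'I, hs's⟩ : ∃ s' : Finset D, (s' : Set D) ⊆ I ∧
        ∀ u ∈ s, ∃ g ∈ s', algebraMap D L g = u := by
      choose! φ hφ hφ' using fun u (hu : u ∈ s) => (FractionalIdeal.mem_coeIdeal _).mp (hsI u hu)
      refine ⟨s.image φ, ?_, fun u hu => ⟨φ u, Finset.mem_image_of_mem _ hu, hφ' u hu⟩⟩
      intro g hg
      obtain ⟨u, hu, rfl⟩ := Finset.mem_image.mp (Finset.mem_coe.mp hg)
      exact hφ u hu
    obtain ⟨a, b, hb, hab, hIab⟩ := h s' hs'I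
    have hb' : algebraMap D L b ≠ 0 := by simpa using hb
    obtain ⟨g, rfl⟩ := (FractionalIdeal.mem_one_iff _).mp
      (vClosure_le_one hJ0 (hJI.trans FractionalIdeal.coeIdeal_le_one) hx)
    have hmem : algebraMap D L a / algebraMap D L b ∈ 1 / J := by
      rw [FractionalIdeal.mem_div_iff_of_ne_zero hJ0]
      intro y hy
      replace hy : y ∈ Submodule.span D (s : Set L) := by rw [hs]; exact hy
      induction hy using Submodule.span_induction with
      | mem u hu =>
        obtain ⟨g', hg', rfl⟩ := hs's u hu
        obtain ⟨c, hc⟩ := hab g' hg'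
        refine (FractionalIdeal.mem_one_iff _).mpr ⟨c, ?_⟩
        rw [div_mul_eq_mul_div, eq_div_iff hb', ← map_mul, ← map_mul, hc, mul_comm]
      | zero => simp
      | add u v _ _ hu hv => rw [mul_add]; exact Submodule.add_mem _ hu hv
      | smul r u _ hu => rw [mul_smul_comm]; exact Submodule.smul_mem _ r hu
    obtain ⟨c, hc⟩ := (FractionalIdeal.mem_one_iff _).mp ((mem_vClosure hJ0).mp hx _ hmem)
    refine FractionalIdeal.mem_coeIdeal_of_mem _ (hIab g ⟨c, ?_⟩)
    rw [mul_div_assoc', eq_div_iff hb', ← map_mul, ← map_mul] at hc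
    rw [mul_comm b, FaithfulSMul.algebraMap_injective D L hc, mul_comm]
  · intro x hx
    -- The extra generator `c` keeps the finitely generated ideal nonzero when `x` is 0.
    obtain ⟨c, hc, hc0⟩ := Submodule.exists_mem_ne_zero_of_ne_bot hI
    obtain ⟨g, hg, rfl⟩ := (FractionalIdeal.mem_coeIdeal _).mp hx
    have hle : Ideal.span {g, c} ≤ I := Ideal.span_le.mpr (by
      rintro _ (rfl | rfl) <;> assumption)
    have h0 : frac (Ideal.span {g, c}) ≠ 0 := FractionalIdeal.coeIdeal_ne_zero.mpr fun hbot =>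
      hc0 (by rw [← Ideal.mem_bot, ← hbot]; exact Ideal.subset_span (by simp))
    refine ⟨frac (Ideal.span {g, c}), h0, ?_, (FractionalIdeal.coeIdeal_le_coeIdeal L).mpr hle,
      le_vClosure h0 (FractionalIdeal.mem_coeIdeal_of_mem _ (Ideal.subset_span (by simp)))⟩
    exact (FractionalIdeal.coeIdeal_fg D⁰ (FaithfulSMul.algebraMap_injective D L) _).mpr
      (Submodule.fg_span (Set.toFinite _))

end Domain

/-! ### Complete integral closedness through factorial extensions. -/

/-- If `q ^ n ∣ a * p ^ n` for all `n` in a unique factorization domain, then `q ∣ p`. -/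
theorem dvd_of_forall_pow_dvd_mul_pow {U : Type*} [CommRing U] [IsDomain U]
    [UniqueFactorizationMonoid U] {a p q : U} (ha : a ≠ 0) (hq : q ≠ 0)
    (h : ∀ n : ℕ, q ^ n ∣ a * p ^ n) : q ∣ p := by
  obtain ⟨p', q', c, hrel, rfl, rfl⟩ := UniqueFactorizationMonoid.exists_reduced_factors' p q hq
  have hc : c ≠ 0 := left_ne_zero_of_mul hq
  -- In lowest terms q' is prime to p'. A nonunit has only finitely many powers dividing a ≠ 0, so
  -- q' is a unit.
  have hdvd : ∀ n : ℕ, q' ^ n ∣ a := by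
    intro n
    have := h n
    rw [mul_pow, mul_pow, mul_left_comm, mul_dvd_mul_iff_left (pow_ne_zero n hc)] at this
    exact (hrel.symm.pow_left.pow_right).dvd_of_dvd_mul_right this
  have hunit : IsUnit q' := by
    by_contra hu
    obtain ⟨n, hn⟩ := FiniteMultiplicity.of_not_isUnit hu ha
    exact hn (hdvd _)
  exact mul_dvd_mul_left c (hunit.dvd)

/-- A domain is completely integrally closed if it is completely integrally closed in
some factorial extension. -/
theorem isCompletelyIntegrallyClosed_of_extension {D U : Type*} [CommRing D] [IsDomain D]
    [CommRing U] [IsDomain U] [UniqueFactorizationMonoid U] [Algebra D U] [FaithfulSMul D U]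
    (h : completeIntegralClosure D U = ⊥) : IsCompletelyIntegrallyClosed D := by
  have hinj := FaithfulSMul.algebraMap_injective D U
  refine eq_bot_iff.mpr ?_
  rintro s ⟨a, ha, has⟩
  obtain ⟨p, q, hq, rfl⟩ := IsFractionRing.div_surjective (A := D) s
  have hq0 := nonZeroDivisors.ne_zero hq
  have hq0' : algebraMap D U q ≠ 0 := by simpa using hq0
  have hpow : ∀ n : ℕ, ∃ c : D, a * p ^ n = q ^ n * c := by
    intro n
    obtain ⟨c, hc⟩ := has n
    refine ⟨c, FaithfulSMul.algebraMap_injective D (FractionRing D) ?_⟩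
    rw [map_mul, map_mul, hc, Algebra.smul_def, div_pow, map_pow, map_pow]
    have : algebraMap D (FractionRing D) q ≠ 0 := by simpa using hq0
    field_simp
  have hdvd : algebraMap D U q ∣ algebraMap D U p := by
    apply dvd_of_forall_pow_dvd_mul_pow (a := algebraMap D U a)
      (by simpa using nonZeroDivisors.ne_zero ha) hq0'
    intro n
    obtain ⟨c, hc⟩ := hpow n
    exact ⟨algebraMap D U c, by simp only [← map_pow, ← map_mul, hc]⟩
  obtain ⟨f, hf⟩ := hdvd
  have hfm : f ∈ completeIntegralClosure D U := by
    refine ⟨a, ha, fun n => ?_⟩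
    obtain ⟨c, hc⟩ := hpow n
    refine ⟨c, mul_left_cancel₀ (pow_ne_zero n hq0') ?_⟩
    rw [← map_pow, ← map_mul, ← hc, map_mul, map_pow, hf, Algebra.smul_def, mul_pow, map_pow]
    ring
  rw [h, Algebra.mem_bot] at hfm
  obtain ⟨F, rfl⟩ := hfm
  rw [← map_mul] at hf
  rw [hinj hf, map_mul, mul_div_cancel_left₀ _ (by simpa using hq0)]
  exact Subalgebra.algebraMap_mem _ F

-- The factorial extension is K[X], K the fraction field of D; coefficients of a polynomial almost
-- integral over D[X] are almost integral over D.
attribute [local instance] Polynomial.algebra in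
theorem IsCompletelyIntegrallyClosed.polynomial {D : Type*} [CommRing D] [IsDomain D]
    (hD : IsCompletelyIntegrallyClosed D) : IsCompletelyIntegrallyClosed D[X] := by
  have : FaithfulSMul D[X] (FractionRing D)[X] :=
    (faithfulSMul_iff_algebraMap_injective _ _).mpr
      (Polynomial.map_injective _ (FaithfulSMul.algebraMap_injective D (FractionRing D)))
  apply isCompletelyIntegrallyClosed_of_extension (U := (FractionRing D)[X])
  refine eq_bot_iff.mpr fun f hf => ?_
  have hcoeff : ∀ i, f.coeff i ∈ completeIntegralClosure D (FractionRing D) :=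
    fun i => IsAlmostIntegral.coeff hf i
  rw [show completeIntegralClosure D (FractionRing D) = ⊥ from hD] at hcoeff
  rw [Algebra.mem_bot]
  have : f ∈ Polynomial.lifts (algebraMap D (FractionRing D)) :=
    (Polynomial.lifts_iff_coeff_lifts _).mpr fun i => Algebra.mem_bot.mp (hcoeff i)
  exact (Polynomial.mem_lifts _).mp this

/-! ### Contracting linear polynomials from the fraction field. -/

/-- Divisibility over the fraction field, expressed in `D[X]`. -/
theorem map_fractionRing_dvd_map_iff {D : Type*} [CommRing D] [IsDomain D] {f g : D[X]} :
    f.map (algebraMap D (FractionRing D)) ∣ g.map (algebraMap D (FractionRing D)) ↔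
      ∃ b : D, b ≠ 0 ∧ f ∣ Polynomial.C b * g := by
  constructor
  · rintro ⟨h, hh⟩
    obtain ⟨b, hb, hH⟩ := IsLocalization.integerNormalization_spec D⁰ h
    refine ⟨b, nonZeroDivisors.ne_zero hb, IsLocalization.integerNormalization D⁰ h,
      Polynomial.map_injective _ (FaithfulSMul.algebraMap_injective D (FractionRing D)) ?_⟩
    have hsmul : b • h = Polynomial.C (algebraMap D (FractionRing D) b) * h := by
      ext i
      rw [Polynomial.coeff_smul, Polynomial.coeff_C_mul, Algebra.smul_def]
    rw [Polynomial.map_mul, Polynomial.map_mul, hH, Polynomial.map_C, hh, hsmul, mul_left_comm]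
  · rintro ⟨b, hb, h⟩
    have hu : IsUnit (Polynomial.C (algebraMap D (FractionRing D) b)) :=
      Polynomial.isUnit_C.mpr (IsUnit.mk0 _ (by simpa using hb))
    rw [← hu.dvd_mul_left, ← Polynomial.map_C, ← Polynomial.map_mul]
    exact Polynomial.map_dvd _ h

theorem isPrime_comap_span_map_linear {D : Type*} [CommRing D] [IsDomain D] {a b : D}
    (hb : b ≠ 0) :
    ((Ideal.span {(Polynomial.C a + Polynomial.C b * Polynomial.X).map
      (algebraMap D (FractionRing D))}).comap
        (Polynomial.mapRingHom (algebraMap D (FractionRing D)))).IsPrime := by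
  have hdeg : ((Polynomial.C a + Polynomial.C b * Polynomial.X).map
      (algebraMap D (FractionRing D))).degree = 1 := by
    rw [Polynomial.map_add, Polynomial.map_mul, Polynomial.map_C, Polynomial.map_C,
      Polynomial.map_X, add_comm, Polynomial.degree_linear (by simpa using hb)]
  have hprime := (Polynomial.irreducible_of_degree_eq_one hdeg).prime
  have := (Ideal.span_singleton_prime hprime.ne_zero).mpr hprime
  exact Ideal.comap_isPrime _ _

end StarIdeals

/-! ### Membership in R, read off monomials. -/

namespace MonomialExample

open MvPolynomial

variable {k : Type*} [Field k]

theorem mem_R_iff {f : MvPolynomial Var k} :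
    f ∈ R k ↔ ∀ m ∈ f.support, ∀ n : ℕ+, m (Var.t n) ≤ m Var.y + m Var.z := by
  constructor
  · intro hf
    rw [← Subalgebra.mem_toSubmodule, Algebra.adjoin_eq_span, Submonoid.closure_eq] at hf
    induction hf using Submodule.span_induction with
    | mem f hf =>
      obtain ⟨m, hm, rfl⟩ := hf
      intro m' hm'
      rwa [Finset.mem_singleton.mp (support_monomial_subset hm')]
    | zero => simp
    | add f g _ _ hf hg =>
      classical
      intro m hm
      exact (Finset.mem_union.mp (support_add hm)).elim (hf m) (hg m)
    | smul c f _ hf => exact fun m hm => hf m (support_smul hm)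
  · intro hf
    rw [f.as_sum]
    refine Subalgebra.sum_mem _ fun m hm => ?_
    have hS : monomial m (1 : k) ∈ S k := ⟨m, hf m hm, rfl⟩
    rw [← mul_one (f.coeff m), ← smul_eq_mul, ← smul_monomial]
    exact Subalgebra.smul_mem _ (Algebra.subset_adjoin hS) _

theorem X_mul_mem_R_iff {v : Var} {f : MvPolynomial Var k} :
    X v * f ∈ R k ↔ ∀ m ∈ f.support, ∀ n : ℕ+,
      Finsupp.single v 1 (Var.t n) + m (Var.t n) ≤
        (Finsupp.single v 1 Var.y + m Var.y) + (Finsupp.single v 1 Var.z + m Var.z) := by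
  rw [mem_R_iff, support_X_mul]
  simp

/-- Membership in R sees y and z only through their total degree. -/
theorem y_mul_mem_R_iff {f : MvPolynomial Var k} :
    X Var.y * f ∈ R k ↔ X Var.z * f ∈ R k := by
  classical
  rw [X_mul_mem_R_iff, X_mul_mem_R_iff]
  refine forall₂_congr fun m _ => forall_congr' fun n => ?_
  simp only [Finsupp.single_apply, reduceCtorEq, if_true, if_false]
  omega

theorem t_mul_mem_R_iff {n₀ : ℕ+} {f : MvPolynomial Var k} :
    X (Var.t n₀) * f ∈ R k ↔ ∀ m ∈ f.support, ∀ n : ℕ+,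
      (if n = n₀ then 1 else 0) + m (Var.t n) ≤ m Var.y + m Var.z := by
  classical
  rw [X_mul_mem_R_iff]
  refine forall₂_congr fun m _ => forall_congr' fun n => ?_
  simp [Finsupp.single_apply, eq_comm]

/-! ### Complete integral closedness -/

/-- The weight for which `y`, `z` have weight `1`, `t_n` has weight `-1`, and the other
variables have weight `0`. -/
def weight (n : ℕ+) : Var → ℤ
  | Var.y => 1
  | Var.z => 1
  | Var.t j => if j = n then -1 else 0

/-- The grading homomorphism of the weight `weight n`, with values in Laurent series. -/
noncomputable def grading (k : Type*) [Field k] (n : ℕ+) :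
    MvPolynomial Var k →+* HahnSeries ℤ (MvPolynomial Var k) :=
  eval₂Hom (HahnSeries.C.comp C) fun v => HahnSeries.single (weight n v) (X v)

theorem grading_monomial (n : ℕ+) (m : Var →₀ ℕ) (c : k) :
    grading k n (monomial m c) =
      HahnSeries.single ((m Var.y + m Var.z : ℤ) - m (Var.t n)) (monomial m c) := by
  classical
  induction m using Finsupp.induction_linear generalizing c with
  | zero => simp [grading, HahnSeries.C_apply]
  | add m m' hm hm' =>
    have : monomial (m + m') c = monomial m c * monomial m' (1 : k) := by
      rw [monomial_mul, mul_one]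
    rw [this, map_mul, hm, hm', HahnSeries.single_mul_single]
    congr 2
    simp only [Finsupp.add_apply]
    push_cast
    ring
  | single v a =>
    rw [monomial_eq, map_mul]
    simp only [Finsupp.prod_single_index, pow_zero, map_pow]
    have hC : grading k n (C c) = HahnSeries.C (C c) := by simp [grading]
    have hX : grading k n (X v) = HahnSeries.single (weight n v) (X v) := by simp [grading]
    rw [hC, hX, HahnSeries.single_pow, HahnSeries.C_apply, HahnSeries.single_mul_single, zero_add]
    congr 1
    cases v <;> simp [weight, Finsupp.single_apply]
    split_ifs <;> simp

theorem coeff_coeff_grading (n : ℕ+) (f : MvPolynomial Var k) (j : ℤ) (m : Var →₀ ℕ) :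
    ((grading k n f).coeff j).coeff m =
      if j = (m Var.y + m Var.z : ℤ) - m (Var.t n) then f.coeff m else 0 := by
  classical
  induction f using MvPolynomial.induction_on' with
  | monomial m' c =>
    rw [grading_monomial, HahnSeries.coeff_single, coeff_monomial]
    by_cases h : m' = m
    · subst h
      rw [if_pos rfl]
      split_ifs <;> simp
    · split_ifs <;> simp [h]
  | add f g hf hg =>
    rw [map_add, HahnSeries.coeff_add, MvPolynomial.coeff_add, hf, hg, MvPolynomial.coeff_add]
    split_ifs <;> simp

theorem grading_eq_zero_iff {n : ℕ+} {f : MvPolynomial Var k} : grading k n f = 0 ↔ f = 0 := by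
  refine ⟨fun h => ?_, fun h => by rw [h, map_zero]⟩
  ext m
  have := coeff_coeff_grading n f ((m Var.y + m Var.z : ℤ) - m (Var.t n)) m
  simpa [h] using this.symm

theorem mem_R_iff_order {f : MvPolynomial Var k} :
    f ∈ R k ↔ ∀ n, 0 ≤ (grading k n f).order := by
  by_cases h0 : f = 0
  -- The order of the zero series is 0 by convention.
  · simp [h0]
  rw [mem_R_iff]
  constructor
  · intro h n
    rw [HahnSeries.le_order_iff_forall (grading_eq_zero_iff.not.mpr h0)]
    intro j hj
    ext m
    rw [coeff_coeff_grading, MvPolynomial.coeff_zero]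
    split_ifs with hjm
    · by_contra hm
      have := h m (mem_support_iff.mpr hm) n
      omega
    · rfl
  · intro h m hm n
    have hle := HahnSeries.order_le_of_coeff_ne_zero (x := grading k n f)
      (g := (m Var.y + m Var.z : ℤ) - m (Var.t n)) (fun hz => by
        have := coeff_coeff_grading n f ((m Var.y + m Var.z : ℤ) - m (Var.t n)) m
        rw [hz, if_pos rfl, MvPolynomial.coeff_zero] at this
        exact mem_support_iff.mp hm this.symm)
    have := h n
    omega

theorem isCompletelyIntegrallyClosed_R :
    StarIdeals.IsCompletelyIntegrallyClosed (R k) := by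
  apply StarIdeals.isCompletelyIntegrallyClosed_of_extension (U := MvPolynomial Var k)
  refine eq_bot_iff.mpr ?_
  rintro f ⟨a, ha, haf⟩
  suffices hf : f ∈ R k from Algebra.mem_bot.mpr ⟨⟨f, hf⟩, rfl⟩
  by_cases h0 : f = 0
  · rw [h0]; exact zero_mem _
  have ha0 : (a : MvPolynomial Var k) ≠ 0 := by simpa using nonZeroDivisors.ne_zero ha
  rw [mem_R_iff_order]
  intro n
  by_contra! hneg
  have horder : ∀ N : ℕ,
      0 ≤ (grading k n (a : MvPolynomial Var k)).order + N * (grading k n f).order := by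
    intro N
    obtain ⟨c, hc⟩ := haf N
    have hmem : (a : MvPolynomial Var k) * f ^ N ∈ R k := by
      have : (a : MvPolynomial Var k) * f ^ N = c := hc.symm
      rw [this]; exact c.2
    have := mem_R_iff_order.mp hmem n
    rwa [map_mul, map_pow, HahnSeries.order_mul (grading_eq_zero_iff.not.mpr ha0)
      (pow_ne_zero N (grading_eq_zero_iff.not.mpr h0)), HahnSeries.order_pow, nsmul_eq_mul] at this
  -- As the order of `f` is at most -1, this exponent makes the total order negative.
  have := horder ((grading k n (a : MvPolynomial Var k)).order.toNat + 1)
  push_cast at this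
  have h1 := Int.self_le_toNat (grading k n (a : MvPolynomial Var k)).order
  have h2 : (0 : ℤ) ≤ (grading k n (a : MvPolynomial Var k)).order.toNat := by positivity
  nlinarith

/-! ### The ideals `P` and `Q R[X]` -/

variable (k) in
/-- The polynomial `y + z X` over `R`. -/
noncomputable def linearPoly : (R k)[X] :=
  Polynomial.C (yR k) + Polynomial.C (zR k) * Polynomial.X

variable (k) in
/-- The polynomial `y + z X` over `k[y, z, t]`. -/
noncomputable def linearPolyMv : (MvPolynomial Var k)[X] :=
  Polynomial.C (X Var.y) + Polynomial.C (X Var.z) * Polynomial.X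

theorem map_linearPoly :
    (linearPoly k).map (algebraMap (R k) (MvPolynomial Var k)) = linearPolyMv k := by
  simp [linearPoly, linearPolyMv, yR, zR]

theorem yR_ne_zero : yR k ≠ 0 := fun h => X_ne_zero Var.y (congrArg Subtype.val h)

theorem zR_ne_zero : zR k ≠ 0 := fun h => X_ne_zero Var.z (congrArg Subtype.val h)

/-- Its degree in X is 1 and its coefficients y, z are relatively prime, so it is irreducible in a
factorial ring. -/
theorem prime_linearPolyMv : Prime (linearPolyMv k) := by
  rw [← UniqueFactorizationMonoid.irreducible_iff_prime, linearPolyMv, add_comm]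
  refine Polynomial.irreducible_C_mul_X_add_C (X_ne_zero _) ?_
  rw [(X_prime (i := Var.z)).irreducible.isRelPrime_iff_not_dvd, X_dvd_X]
  simp

theorem linearPolyMv_not_dvd_C {a : MvPolynomial Var k} (ha : a ≠ 0) :
    ¬ linearPolyMv k ∣ Polynomial.C a := by
  intro h
  have := Polynomial.natDegree_le_of_dvd h (by simpa using ha)
  rw [linearPolyMv, add_comm, Polynomial.natDegree_linear (X_ne_zero _)] at this
  simp at this

theorem coeff_linearPolyMv_mul_zero (h : (MvPolynomial Var k)[X]) :
    (linearPolyMv k * h).coeff 0 = X Var.y * h.coeff 0 := by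
  simp [linearPolyMv, add_mul, mul_assoc]

theorem coeff_linearPolyMv_mul_succ (h : (MvPolynomial Var k)[X]) (i : ℕ) :
    (linearPolyMv k * h).coeff (i + 1) = X Var.y * h.coeff (i + 1) + X Var.z * h.coeff i := by
  simp [linearPolyMv, add_mul, mul_assoc]

/-- After clearing a denominator b ∈ R, the prime y + zX divides bg but not the constant b. The
quotient need not have coefficients in R. -/
theorem linearPolyMv_dvd_of_mem_P {g : (R k)[X]} (hg : g ∈ P k) :
    linearPolyMv k ∣ g.map (algebraMap (R k) (MvPolynomial Var k)) := by
  obtain ⟨b, hb, H, heq⟩ := StarIdeals.map_fractionRing_dvd_map_iff.mp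
    (Ideal.mem_span_singleton.mp (Ideal.mem_comap.mp hg))
  change _ = linearPoly k * H at heq
  have heq' := congrArg (Polynomial.map (algebraMap (R k) (MvPolynomial Var k))) heq
  rw [Polynomial.map_mul, Polynomial.map_mul, map_linearPoly, Polynomial.map_C] at heq'
  exact (prime_linearPolyMv.dvd_or_dvd ⟨_, heq'⟩).resolve_left
    (linearPolyMv_not_dvd_C (by simpa using hb))

/-- Comparing coefficients gives y h_0 = g_0 and y h_{i+1} = g_{i+1} - z h_i; the exchange of y and
z drives the induction. -/
theorem z_mul_coeff_mem_R {g : (R k)[X]} {h : (MvPolynomial Var k)[X]}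
    (hg : g.map (algebraMap (R k) (MvPolynomial Var k)) = linearPolyMv k * h) (i : ℕ) :
    X Var.z * h.coeff i ∈ R k := by
  rw [← y_mul_mem_R_iff]
  induction i with
  | zero =>
    rw [← coeff_linearPolyMv_mul_zero, ← hg, Polynomial.coeff_map]
    exact (g.coeff 0).2
  | succ i ih =>
    have := coeff_linearPolyMv_mul_succ h i
    rw [← hg, Polynomial.coeff_map] at this
    rw [← sub_eq_iff_eq_add.mpr this]
    exact sub_mem (g.coeff (i + 1)).2 (y_mul_mem_R_iff.mp ih)

/-- One denominator, z, serves for every element of P; this is the form `isDivisorial_frac` needs.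
-/
theorem mem_P_iff {g : (R k)[X]} :
    g ∈ P k ↔ linearPoly k ∣ Polynomial.C (zR k) * g := by
  constructor
  · intro hg
    obtain ⟨h, hh⟩ := linearPolyMv_dvd_of_mem_P hg
    have hlift : Polynomial.C (X Var.z) * h ∈
        Polynomial.lifts (algebraMap (R k) (MvPolynomial Var k)) :=
      (Polynomial.lifts_iff_coeff_lifts _).mpr fun i =>
        ⟨⟨_, z_mul_coeff_mem_R hh i⟩, by rw [Polynomial.coeff_C_mul]; rfl⟩
    obtain ⟨H, hH⟩ := (Polynomial.mem_lifts _).mp hlift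
    refine ⟨H, Polynomial.map_injective _
      (FaithfulSMul.algebraMap_injective (R k) (MvPolynomial Var k)) ?_⟩
    rw [Polynomial.map_mul, Polynomial.map_mul, hh, hH, map_linearPoly, Polynomial.map_C,
      mul_left_comm]
    rfl
  · exact fun h => Ideal.mem_comap.mpr (Ideal.mem_span_singleton.mpr
      (StarIdeals.map_fractionRing_dvd_map_iff.mpr ⟨zR k, zR_ne_zero, h⟩))

theorem linearPoly_ne_zero : linearPoly k ≠ 0 := by
  intro h
  have := (prime_linearPolyMv (k := k)).ne_zero
  rw [← map_linearPoly, h, Polynomial.map_zero] at this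
  exact this rfl

theorem P_ne_bot : P k ≠ ⊥ := by
  intro h
  have : linearPoly k ∈ P k := mem_P_iff.mpr (dvd_mul_left _ _)
  rw [h] at this
  exact linearPoly_ne_zero this

theorem isPrime_P : (P k).IsPrime :=
  StarIdeals.isPrime_comap_span_map_linear zR_ne_zero

theorem comap_C_P : (P k).comap Polynomial.C = ⊥ := by
  refine eq_bot_iff.mpr fun a ha => ?_
  by_contra h0
  refine linearPolyMv_not_dvd_C (k := k) (a := (a : MvPolynomial Var k)) ?_ ?_
  · simpa using h0
  · have := linearPolyMv_dvd_of_mem_P (Ideal.mem_comap.mp ha)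
    rwa [Polynomial.map_C] at this

/-! ### Containment of P in QR[X], and the `t`-ideal property. -/

theorem mem_Q_iff {f : R k} :
    f ∈ Q k ↔ ∀ m ∈ (f : MvPolynomial Var k).support, m Var.y + m Var.z ≠ 0 := by
  rw [Q, Ideal.mem_comap, ← Set.image_pair, mem_ideal_span_X_image]
  refine forall₂_congr fun m _ => ?_
  simp only [Set.mem_insert_iff, Set.mem_singleton_iff, exists_eq_or_imp, exists_eq_left]
  omega

theorem mem_QRX_iff {g : (R k)[X]} : g ∈ QRX k ↔ ∀ i, g.coeff i ∈ Q k :=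
  Ideal.mem_map_C_iff

theorem C_yR_mem_QRX : Polynomial.C (yR k) ∈ QRX k :=
  Ideal.mem_map_of_mem _ (Ideal.mem_comap.mpr (Ideal.subset_span (Set.mem_insert _ _)))

theorem QRX_ne_top : QRX k ≠ ⊤ := by
  intro h
  have h1 : (1 : (R k)[X]) ∈ QRX k := h ▸ Submodule.mem_top
  have := mem_Q_iff.mp (mem_QRX_iff.mp h1 0) 0 (by simp)
  simp at this

theorem P_lt_QRX : P k < QRX k := by
  refine lt_of_le_of_ne (fun g hg => ?_) fun heq => ?_
  · obtain ⟨h, hh⟩ := linearPolyMv_dvd_of_mem_P hg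
    have hX : ∀ v ∈ ({Var.y, Var.z} : Set Var), ∀ f : MvPolynomial Var k,
        X v * f ∈ Ideal.span {X Var.y, X Var.z} := fun v hv f =>
      Ideal.mul_mem_right _ _ (Ideal.subset_span (by rcases hv with rfl | rfl <;> simp))
    refine mem_QRX_iff.mpr fun i => Ideal.mem_comap.mpr ?_
    rw [← Polynomial.coeff_map, hh]
    cases i with
    | zero => rw [coeff_linearPolyMv_mul_zero]; exact hX _ (by simp) _
    | succ i =>
      rw [coeff_linearPolyMv_mul_succ]
      exact add_mem (hX _ (by simp) _) (hX _ (by simp) _)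
  · have : yR k ∈ (P k).comap Polynomial.C := Ideal.mem_comap.mpr (heq ▸ C_yR_mem_QRX)
    rw [comap_C_P] at this
    exact yR_ne_zero this

theorem exists_t_notMem_vars (s : Finset (R k)[X]) :
    ∃ n : ℕ+, ∀ g ∈ s, ∀ i, ∀ m ∈ (g.coeff i : MvPolynomial Var k).support, m (Var.t n) = 0 := by
  classical
  let F : Finset Var := s.biUnion fun g => g.support.biUnion fun i =>
    (g.coeff i : MvPolynomial Var k).vars
  have hinj : Function.Injective Var.t := fun _ _ h => Var.t.inj h
  obtain ⟨n, hn⟩ := Infinite.exists_notMem_finset (F.preimage Var.t hinj.injOn)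
  refine ⟨n, fun g hg i m hm => ?_⟩
  by_contra hne
  refine hn (Finset.mem_preimage.mpr (Finset.mem_biUnion.mpr ⟨g, hg, Finset.mem_biUnion.mpr
    ⟨i, ?_, mem_vars_iff_mem_support _ |>.mpr ⟨m, hm, by simpa using hne⟩⟩⟩))
  rw [Polynomial.mem_support_iff]
  intro h0
  rw [h0] at hm
  simp at hm

variable (k) in
/-- The monomial `y t_n` as an element of `R`. -/
noncomputable def ytR (n : ℕ+) : R k :=
  ⟨X Var.y * X (Var.t n), y_mul_mem_R_iff.mpr <| X_mul_mem_R_iff.mpr <| by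
    classical
    intro m hm j
    rw [support_X, Finset.mem_singleton] at hm
    subst hm
    simp only [Finsupp.single_apply, reduceCtorEq, if_true, if_false]
    split_ifs <;> simp⟩

/-- Multiplication by t_n, which is not in R, is expressed through the fraction (y t_n)/y. -/
theorem yR_dvd_ytR_mul_iff {n : ℕ+} {f : R k} :
    yR k ∣ ytR k n * f ↔ X (Var.t n) * f.1 ∈ R k := by
  constructor
  · rintro ⟨c, hc⟩
    have := congrArg Subtype.val hc
    change X Var.y * X (Var.t n) * f.1 = X Var.y * c.1 at this
    rw [mul_assoc] at this
    rw [mul_left_cancel₀ (X_ne_zero _) this]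
    exact c.2
  · exact fun h => ⟨⟨_, h⟩, Subtype.ext (mul_assoc _ _ _)⟩

theorem isTIdeal_QRX : StarIdeals.IsTIdeal (StarIdeals.frac (D := (R k)[X]) (QRX k)) := by
  refine StarIdeals.isTIdeal_frac (fun h => ?_) fun s hs => ?_
  · have := C_yR_mem_QRX (k := k)
    rw [h, Ideal.mem_bot, Polynomial.C_eq_zero] at this
    exact yR_ne_zero this
  obtain ⟨n, hn⟩ := exists_t_notMem_vars s
  refine ⟨Polynomial.C (ytR k n), Polynomial.C (yR k), by simpa using yR_ne_zero,
    fun g hg => ?_, fun g hg => ?_⟩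
  -- Multiplying by t_n raises the degree in t_n from 0 to 1, and monomials of elements of Q have
  -- degree at least 1 in y, z.
  · rw [Polynomial.C_dvd_iff_dvd_coeff]
    intro i
    rw [Polynomial.coeff_C_mul, yR_dvd_ytR_mul_iff, t_mul_mem_R_iff]
    intro m hm j
    have h1 := mem_Q_iff.mp (mem_QRX_iff.mp (hs hg) i) m hm
    have h2 := hn g hg i m hm
    have h3 := mem_R_iff.mp (g.coeff i).2 m hm j
    split_ifs with hj
    · subst hj; omega
    · omega
  -- Conversely, 1 + deg_{t_n} m ≤ deg_{y,z} m forces deg_{y,z} m > 0.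
  · rw [Polynomial.C_dvd_iff_dvd_coeff] at hg
    refine mem_QRX_iff.mpr fun i => mem_Q_iff.mpr fun m hm => ?_
    have := hg i
    rw [Polynomial.coeff_C_mul, yR_dvd_ytR_mul_iff, t_mul_mem_R_iff] at this
    have := this m hm n
    rw [if_pos rfl] at this
    omega

end MonomialExample

theorem mainTheorem1 (k : Type*) [Field k] :
    StarIdeals.IsCompletelyIntegrallyClosed (MonomialExample.R k) ∧
    StarIdeals.IsCompletelyIntegrallyClosed (Polynomial (MonomialExample.R k)) ∧
    StarIdeals.IsUpperToZero (D := MonomialExample.R k) (MonomialExample.P k) ∧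
    StarIdeals.IsVInvertible
      (StarIdeals.frac (D := Polynomial (MonomialExample.R k)) (MonomialExample.P k)) ∧
    StarIdeals.IsMaximalDivisorial (D := Polynomial (MonomialExample.R k)) (MonomialExample.P k) ∧
    ¬ StarIdeals.IsTMaximal (D := Polynomial (MonomialExample.R k)) (MonomialExample.P k) ∧
    MonomialExample.QRX k ≠ ⊤ ∧
    StarIdeals.IsTIdeal
      (StarIdeals.frac (D := Polynomial (MonomialExample.R k)) (MonomialExample.QRX k)) ∧
    MonomialExample.P k < MonomialExample.QRX k := by
  have hR := MonomialExample.isCompletelyIntegrallyClosed_R (k := k)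
  have hdiv : StarIdeals.IsDivisorial
      (StarIdeals.frac (D := (MonomialExample.R k)[X]) (MonomialExample.P k)) :=
    StarIdeals.isDivisorial_frac (D := (MonomialExample.R k)[X]) MonomialExample.P_ne_bot
      MonomialExample.linearPoly_ne_zero fun _ => MonomialExample.mem_P_iff
  have hinv := hR.polynomial.isVInvertible hdiv.1
  refine ⟨hR, hR.polynomial,
    ⟨MonomialExample.isPrime_P, MonomialExample.P_ne_bot, MonomialExample.comap_C_P⟩, hinv,
    StarIdeals.isMaximalDivisorial_of_isVInvertible MonomialExample.isPrime_P hdiv hinv,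
    fun hmax => ?_, MonomialExample.QRX_ne_top, MonomialExample.isTIdeal_QRX,
    MonomialExample.P_lt_QRX⟩
  exact MonomialExample.P_lt_QRX.not_ge
    (hmax.2 ⟨MonomialExample.QRX_ne_top, MonomialExample.isTIdeal_QRX⟩
      MonomialExample.P_lt_QRX.le)
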